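/- Let $P=\{0,2,3,4,\dots\}\subset\mathbb N$ and let $P\rtimes\mathbb N^\times$ be the monoid of pairs $(m,a)$ with $m\in P$, $a\in\mathbb N^\times=\{1,2,3,\dots\}$ and product $(m,a)(n,b)=(m+an,ab)$. For $(m,a),(n,b)$ with $(m+aP)\cap(n+bP)\neq\emptyset$ put $(m,a)\Cup(n,b)=(\ell,\mathrm{lcm}(a,b))$, where $\ell$ is the smallest element of $(m+aP)\cap(n+bP)$ in the usual order. A covariant isometric representation of $P\rtimes\mathbb N^\times$ in a unital $C^*$-algebra is a map $W$ into isometries with $W_{(0,1)}=1$, $W_{xy}=W_xW_y$, and, for all $x=(m,a)$, $y=(n,b)$, $$W_xW_x^*W_yW_y^*=\begin{cases}0&\text{if }(m+aP)\cap(n+bP)=\emptyset,\\ W_{x\Cup y}W_{x\Cup y}^*&\text{if }(m+aP)\cap(n+bP)\neq\emptyset.\end{cases}$$ Let $\mathcal T(P\rtimes\mathbb N^\times)$ (the generalized Toeplitz algebra) be the universal unital $C^*$-algebra generated by a covariant isometric representation $W$ of $P\rtimes\mathbb N^\times$. Let $\mathcal A$ be the universal unital $C^*$-algebra generated by isometries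 $s$, $t$ and $\upsilon_p$ ($p$ prime) subject to the following relations, for all primes $p,q$ and all integers $k,k_1,k_2\ge 0$: * (R1) $t^2=s^3$; * (R2) $ts=st$, $s^*t=ts^*$, $t^*s=st^*$; * (T1) $\upsilon_ps=s^p\upsilon_p$, $\upsilon_pt=t^p\upsilon_p$, $\upsilon_ps^*=s^{*p}\upsilon_p$, $\upsilon_pt^*=t^{*p}\upsilon_p$; * (T2) $\upsilon_p\upsilon_q=\upsilon_q\upsilon_p$; * (T3) $\upsilon_p^*\upsilon_q=\upsilon_q\upsilon_p^*$ when $p\ne q$; * (T4) $s^*\upsilon_p=s^{p-1}\upsilon_ps^*$; * (T5) $\upsilon_p^*s^{k_1}t^{k_2}\upsilon_p=0$ for $1\le 2k_1+3k_2<p$; * (T6) $\upsilon_p^*s^k\upsilon_p=0$ for $1\le k<p$ when $p\ne2$, and $\upsilon_2^*s\upsilon_2=ts^*$; $\upsilon_p^*t^k\upsilon_p=0$ for $1\le k<p$ when $p\neq3$, and $\upsilon_3^*t\upsilon_3=ts^*$, $\upsilon_3^*t^2\upsilon_3=s$; $\upsilon_p^*t^ks^{*k}\upsilon_p=0$ for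 $1\le k<p$. Then there is a $*$-isomorphism $\pi$ of $\mathcal T(P\rtimes\mathbb N^\times)$ onto $\mathcal A$ such that $\pi(W_{(2,1)})=s$, $\pi(W_{(3,1)})=t$ and $\pi(W_{(0,p)})=\upsilon_p$ for every prime $p$. -/

import Mathlib

/-! ## Universal C⋆-algebras generated by isometries subject to relations -/

noncomputable section

namespace UnivCStar

open scoped ENNReal CStarAlgebra

/-- The bounded product of a family of nonzero unital C⋆-algebras is a unital C⋆-algebra. -/
instance instCStarAlgebraLp {I : Type*} {A : I → Type*} [∀ i, Nontrivial (A i)]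
    [∀ i, CStarAlgebra (A i)] : CStarAlgebra (lp A ∞) where

/-- A realization, in a nonzero unital C⋆-algebra, of the generators `G` as isometries that
satisfy the relations `Rel`. -/
structure Realization (G : Type) (Rel : ∀ (B : Type) [CStarAlgebra B], (G → B) → Prop) where
  carrier : Type
  [inst : CStarAlgebra carrier]
  [nontriv : Nontrivial carrier]
  gen : G → carrier
  isometry : ∀ g, star (gen g) * gen g = 1
  sat : Rel carrier gen

attribute [instance] Realization.inst Realization.nontriv

theorem norm_le_one_of_isometry {B : Type*} [CStarAlgebra B] [Nontrivial B] {w : B}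
    (h : star w * w = 1) : ‖w‖ ≤ 1 := by
  have h1 : ‖w‖ * ‖w‖ = 1 := by
    rw [← CStarRing.norm_star_mul_self, h, CStarRing.norm_one]
  nlinarith [norm_nonneg w]

variable {G : Type} (Rel : ∀ (B : Type) [CStarAlgebra B], (G → B) → Prop)

/-- The bounded product of all realizations. -/
abbrev Ambient : Type 1 := lp (fun i : Realization G Rel => i.carrier) ∞

/-- The tuple of all realizations of the generator `g`. -/
def ambientGen (g : G) : Ambient Rel :=
  ⟨fun i => i.gen g, memℓp_infty ⟨1, by
    rintro _ ⟨i, rfl⟩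
    exact norm_le_one_of_isometry (i.isometry g)⟩⟩

/-- The C⋆-subalgebra of the bounded product of all realizations that is generated by the
tuples `ambientGen Rel g`: the universal unital C⋆-algebra generated by isometries indexed by `G`
subject to the relations `Rel`. -/
def carrierSubalgebra : StarSubalgebra ℂ (Ambient Rel) :=
  (StarAlgebra.adjoin ℂ (Set.range (ambientGen Rel))).topologicalClosure

/-- The universal unital C⋆-algebra generated by isometries indexed by `G` subject to `Rel`. -/
def Alg : Type 1 := carrierSubalgebra Rel

/-- The C⋆-algebra structure of the universal algebra, inherited from the bounded product. -/
def algCStar : CStarAlgebra (Alg Rel) :=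
  StarSubalgebra.cstarAlgebra (carrierSubalgebra Rel)
    (h_closed := StarSubalgebra.isClosed_topologicalClosure _)

instance : CStarAlgebra (Alg Rel) := algCStar Rel

/-- The inclusion into the bounded product of all realizations. -/
def incl : Alg Rel →⋆ₐ[ℂ] Ambient Rel := (carrierSubalgebra Rel).subtype

theorem isClosedEmbedding_incl : Topology.IsClosedEmbedding (incl Rel) :=
  (StarSubalgebra.isClosed_topologicalClosure _).isClosedEmbedding_subtypeVal

theorem range_incl : Set.range (incl Rel) = carrierSubalgebra Rel :=
  Subtype.range_coe

attribute [irreducible] algCStar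

/-- The canonical generators of the universal C⋆-algebra. -/
def gen (g : G) : Alg Rel :=
  ⟨ambientGen Rel g, StarSubalgebra.le_topologicalClosure _
    (StarAlgebra.subset_adjoin ℂ _ ⟨g, rfl⟩)⟩

@[simp] theorem incl_gen (g : G) : incl Rel (gen Rel g) = ambientGen Rel g := rfl

/-- The coordinate projection to a realization. -/
def proj (i : Realization G Rel) : Alg Rel →⋆ₐ[ℂ] i.carrier where
  toFun x := incl Rel x i
  map_one' := by rw [map_one]; rfl
  map_mul' x y := by rw [map_mul]; rfl
  map_zero' := by rw [map_zero]; rfl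
  map_add' x y := by rw [map_add]; rfl
  commutes' r := by rw [AlgHomClass.commutes]; rfl
  map_star' x := by rw [map_star]; rfl

@[simp] theorem proj_gen (i : Realization G Rel) (g : G) : proj Rel i (gen Rel g) = i.gen g := rfl

theorem proj_jointly_injective (x y : Alg Rel) (h : ∀ i, proj Rel i x = proj Rel i y) : x = y :=
  (isClosedEmbedding_incl Rel).injective (lp.ext (funext h))

/-- The canonical generators generate the universal algebra as a C⋆-algebra. -/
theorem adjoin_gen_dense :
    (StarAlgebra.adjoin ℂ (Set.range (gen Rel))).topologicalClosure = ⊤ := by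
  set T := (StarAlgebra.adjoin ℂ (Set.range (gen Rel))).topologicalClosure with hT
  have hmap : IsClosed ((T.map (incl Rel) : StarSubalgebra ℂ (Ambient Rel)) :
      Set (Ambient Rel)) := by
    rw [StarSubalgebra.coe_map]
    exact (isClosedEmbedding_incl Rel).isClosedMap _ (StarSubalgebra.isClosed_topologicalClosure _)
  have hle : carrierSubalgebra Rel ≤ T.map (incl Rel) := by
    refine StarSubalgebra.topologicalClosure_minimal (StarAlgebra.adjoin_le ?_) hmap
    rintro _ ⟨g, rfl⟩
    exact ⟨gen Rel g, StarSubalgebra.le_topologicalClosure _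
      (StarAlgebra.subset_adjoin ℂ _ ⟨g, rfl⟩), rfl⟩
  refine eq_top_iff.2 fun x _ => ?_
  have hx : incl Rel x ∈ carrierSubalgebra Rel := by
    rw [← SetLike.mem_coe, ← range_incl]
    exact ⟨x, rfl⟩
  obtain ⟨y, hy, hyx⟩ := hle hx
  have : y = x := (isClosedEmbedding_incl Rel).injective hyx
  exact this ▸ hy

/-- Two ⋆-homomorphisms out of the universal algebra that agree on the generators are equal. -/
theorem hom_ext {B : Type*} [CStarAlgebra B] {φ ψ : Alg Rel →⋆ₐ[ℂ] B}
    (h : ∀ g, φ (gen Rel g) = ψ (gen Rel g)) : φ = ψ := by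
  have hle : (StarAlgebra.adjoin ℂ (Set.range (gen Rel))).topologicalClosure ≤
      StarAlgHom.equalizer φ ψ := by
    refine StarSubalgebra.topologicalClosure_minimal (StarAlgebra.adjoin_le ?_)
      (isClosed_eq (map_continuous φ) (map_continuous ψ))
    rintro _ ⟨g, rfl⟩
    exact h g
  rw [adjoin_gen_dense] at hle
  exact StarAlgHom.ext fun x => hle (StarSubalgebra.mem_top (x := x))

section Small

variable {B : Type*} [CStarAlgebra B] (f : G → B)

/-- The C⋆-subalgebra generated by a family of elements. -/
abbrev generated : StarSubalgebra ℂ B :=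
  (StarAlgebra.adjoin ℂ (Set.range f)).topologicalClosure

theorem small_generated : Small.{0} (generated f) := by
  let ev : FreeAlgebra ℂ (G ⊕ G) →ₐ[ℂ] B :=
    FreeAlgebra.lift ℂ (Sum.elim f fun g => star (f g))
  have hadj : ∀ x ∈ StarAlgebra.adjoin ℂ (Set.range f), ∃ y, ev y = x := by
    intro x hx
    have hle : Algebra.adjoin ℂ (Set.range f ∪ star (Set.range f)) ≤ ev.range := by
      refine Algebra.adjoin_le ?_
      rintro z (⟨g, rfl⟩ | hz)
      · exact ⟨FreeAlgebra.ι ℂ (Sum.inl g), by simp [ev]⟩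
      · obtain ⟨g, hg⟩ := hz
        refine ⟨FreeAlgebra.ι ℂ (Sum.inr g), ?_⟩
        simp [ev, hg]
    exact hle hx
  have hsub : (generated f : Set B) ⊆
      Set.range fun u : ℕ → FreeAlgebra ℂ (G ⊕ G) =>
        Filter.limUnder Filter.atTop fun n => ev (u n) := by
    intro x hx
    obtain ⟨u, hu, hux⟩ := mem_closure_iff_seq_limit.1 hx
    choose v hv using fun n => hadj (u n) (hu n)
    refine ⟨v, ?_⟩
    have : (fun n => ev (v n)) = u := funext hv
    simp only [this]
    exact hux.limUnder_eq
  exact small_subset hsub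

/-- Transport of a C⋆-algebra structure along a bijection. -/
abbrev transfer {C D : Type*} [CStarAlgebra D] (e : C ≃ D) : CStarAlgebra C :=
  letI := e.normedRing
  letI := e.algebra ℂ
  letI := e.starRing
  have hn : ∀ x : C, ‖x‖ = ‖e x‖ := fun _ => rfl
  have hm : ∀ x y : C, e (x * y) = e x * e y := fun x y => e.apply_symm_apply _
  have hs : ∀ x : C, e (star x) = star (e x) := fun x => e.apply_symm_apply _
  have hc : ∀ (c : ℂ) (x : C), e (c • x) = c • e x := fun c x => e.apply_symm_apply _
  have hi : Isometry e := Isometry.of_dist_eq fun _ _ => rfl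
  { e.normedRing, e.algebra ℂ, e.starRing with
    norm_smul_le := fun c x => by rw [hn, hn, hc]; exact norm_smul_le c (e x)
    complete := (IsometryEquiv.mk e hi).completeSpace.complete
    star_smul := fun c x => e.injective (by rw [hs, hc, hc, hs, star_smul])
    norm_mul_self_le := fun x => by
      rw [hn, hn, hm, hs]; exact CStarRing.norm_mul_self_le (e x) }

/-- A family of elements of a C⋆-algebra in any universe, indexed by a small type, comes from a
C⋆-algebra in the lowest universe. -/
theorem exists_small_model : ∃ (C : Type) (_ : CStarAlgebra C) (f' : G → C) (φ : C →⋆ₐ[ℂ] B),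
    Function.Injective φ ∧ ∀ g, φ (f' g) = f g := by
  have := small_generated f
  have : IsClosed (generated f : Set B) := StarSubalgebra.isClosed_topologicalClosure _
  let _ : CStarAlgebra (generated f) := StarSubalgebra.cstarAlgebra (generated f)
  let e := (equivShrink.{0} (generated f)).symm
  let _ := transfer e
  let φ : Shrink.{0} (generated f) →⋆ₐ[ℂ] B :=
    { toFun := fun x => (e x : B)
      map_one' := congrArg Subtype.val (e.apply_symm_apply _)
      map_mul' := fun x y => congrArg Subtype.val (e.apply_symm_apply _)
      map_zero' := congrArg Subtype.val (e.apply_symm_apply _)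
      map_add' := fun x y => congrArg Subtype.val (e.apply_symm_apply _)
      commutes' := fun r => congrArg Subtype.val (e.apply_symm_apply _)
      map_star' := fun x => congrArg Subtype.val (e.apply_symm_apply _) }
  refine ⟨Shrink.{0} (generated f), inferInstance, fun g => e.symm ⟨f g,
    StarSubalgebra.le_topologicalClosure _ (StarAlgebra.subset_adjoin ℂ _ ⟨g, rfl⟩)⟩, φ,
    Subtype.val_injective.comp e.injective, fun g => ?_⟩
  exact congrArg Subtype.val (e.apply_symm_apply _)

end Small

/-- Isometries in a C⋆-algebra of any universe are the image of the canonical generators, provided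
that every preimage of them in a C⋆-algebra of the lowest universe satisfies the relations. -/
theorem exists_hom {B : Type*} [CStarAlgebra B] (f : G → B) (hf : ∀ g, star (f g) * f g = 1)
    (hRel : ∀ (C : Type) [CStarAlgebra C] (f' : G → C) (φ : C →⋆ₐ[ℂ] B),
      Function.Injective φ → (∀ g, φ (f' g) = f g) → Rel C f') :
    ∃ π : Alg Rel →⋆ₐ[ℂ] B, ∀ g, π (gen Rel g) = f g := by
  obtain ⟨C, _, f', φ, hφ, hf'⟩ := exists_small_model f
  rcases subsingleton_or_nontrivial C with hC | hC
  · have h01 : (1 : B) = 0 := by rw [← map_one φ, Subsingleton.elim (1 : C) 0, map_zero]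
    have hB : Subsingleton B := subsingleton_of_zero_eq_one h01.symm
    exact ⟨{ toFun := fun _ => 0
             map_one' := Subsingleton.elim _ _
             map_mul' := fun _ _ => Subsingleton.elim _ _
             map_zero' := Subsingleton.elim _ _
             map_add' := fun _ _ => Subsingleton.elim _ _
             commutes' := fun _ => Subsingleton.elim _ _
             map_star' := fun _ => Subsingleton.elim _ _ }, fun _ => Subsingleton.elim _ _⟩
  · let i : Realization G Rel :=
      { carrier := C
        gen := f'
        isometry := fun g => hφ (by rw [map_mul, map_star, hf', hf, map_one])
        sat := hRel C f' φ hφ hf' }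
    exact ⟨φ.comp (proj Rel i), hf'⟩

end UnivCStar

/-! ## The semigroup `P ⋊ ℕ^×` -/

namespace PNToeplitz

/-- The additive semigroup `P = {0, 2, 3, …}`. -/
def P : AddSubmonoid ℕ where
  carrier := {n | n ≠ 1}
  zero_mem' := by simp
  add_mem' := by
    intro a b ha hb
    change a ≠ 1 at ha
    change b ≠ 1 at hb
    change a + b ≠ 1
    omega

theorem mem_P {n : ℕ} : n ∈ P ↔ n ≠ 1 := Iff.rfl

theorem mul_mem_P (a : ℕ) {n : ℕ} (hn : n ∈ P) : a * n ∈ P := by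
  rw [mem_P] at *
  intro h
  exact hn (Nat.eq_one_of_mul_eq_one_left h)

/-- The elements `(m, a)` of the semidirect product `P ⋊ ℕ^×`, with `m ∈ P` and `a ≥ 1`. -/
@[ext]
structure PN where
  /-- the additive component -/
  fst : ℕ
  /-- the multiplicative component -/
  snd : ℕ+
  fst_mem : fst ∈ P

namespace PN

/-- `(m, a) (n, b) = (m + a n, a b)`. -/
instance : Mul PN :=
  ⟨fun x y => ⟨x.fst + x.snd * y.fst, x.snd * y.snd,
    P.add_mem x.fst_mem (mul_mem_P _ y.fst_mem)⟩⟩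

/-- The unit is `(0, 1)`. -/
instance : One PN := ⟨⟨0, 1, P.zero_mem⟩⟩

@[simp] theorem mul_fst (x y : PN) : (x * y).fst = x.fst + x.snd * y.fst := rfl

@[simp] theorem mul_snd (x y : PN) : (x * y).snd = x.snd * y.snd := rfl

@[simp] theorem one_fst : (1 : PN).fst = 0 := rfl

@[simp] theorem one_snd : (1 : PN).snd = 1 := rfl

instance : Monoid PN where
  mul_assoc x y z := by
    ext
    · simp only [mul_fst, mul_snd, PNat.mul_coe]
      ring
    · simp [mul_assoc]
  one_mul x := by ext <;> simp
  mul_one x := by ext <;> simp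

/-- The set `m + a P` attached to `(m, a)`. -/
def translate (x : PN) : Set ℕ := {k | ∃ n ∈ P, k = x.fst + x.snd * n}

theorem translate_subset (x : PN) {k : ℕ} (hk : k ∈ x.translate) : k ∈ P := by
  obtain ⟨n, hn, rfl⟩ := hk
  exact P.add_mem x.fst_mem (mul_mem_P _ hn)

/-- For `x = (m, a)` and `y = (n, b)` with `(m + a P) ∩ (n + b P)` nonempty, the element
`x ⋓ y = (ℓ, lcm(a, b))`, where `ℓ` is the smallest element of that intersection. -/
def cup (x y : PN) (h : (x.translate ∩ y.translate).Nonempty) : PN where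
  fst := sInf (x.translate ∩ y.translate)
  snd := PNat.lcm x.snd y.snd
  fst_mem := x.translate_subset (Nat.sInf_mem h).1

/-- In the order `x ≤ z ↔ z ∈ x (P ⋊ ℕ^×)`, the pair `(k, c)` lies above `(m, a)` exactly when
`k ∈ m + a P` and `a` divides `c`. -/
theorem dvd_iff (x z : PN) : x ∣ z ↔ z.fst ∈ x.translate ∧ x.snd ∣ z.snd := by
  constructor
  · rintro ⟨c, rfl⟩
    exact ⟨⟨c.fst, c.fst_mem, rfl⟩, c.snd, rfl⟩
  · rintro ⟨⟨n, hn, h1⟩, c, h2⟩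
    exact ⟨⟨n, c, hn⟩, PN.ext h1 h2⟩

/-- `x ⋓ y` is a common upper bound, and both its components are the smallest possible. -/
theorem cup_spec (x y : PN) (h : (x.translate ∩ y.translate).Nonempty) :
    (x ∣ cup x y h ∧ y ∣ cup x y h) ∧
      ∀ z, x ∣ z → y ∣ z → (cup x y h).fst ≤ z.fst ∧ (cup x y h).snd ≤ z.snd := by
  refine ⟨⟨(dvd_iff _ _).2 ⟨(Nat.sInf_mem h).1, PNat.dvd_lcm_left _ _⟩,
    (dvd_iff _ _).2 ⟨(Nat.sInf_mem h).2, PNat.dvd_lcm_right _ _⟩⟩, fun z hx hy => ?_⟩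
  obtain ⟨hx1, hx2⟩ := (dvd_iff _ _).1 hx
  obtain ⟨hy1, hy2⟩ := (dvd_iff _ _).1 hy
  exact ⟨Nat.sInf_le ⟨hx1, hy1⟩, PNat.le_of_dvd (PNat.lcm_dvd hx2 hy2)⟩

/-- The element `(2, 1)`. -/
def two : PN := ⟨2, 1, by simp [mem_P]⟩

/-- The element `(3, 1)`. -/
def three : PN := ⟨3, 1, by simp [mem_P]⟩

/-- The element `(0, p)`, for a prime `p`. -/
def prime (p : Nat.Primes) : PN := ⟨0, ⟨p, p.2.pos⟩, P.zero_mem⟩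

end PN

/-! ## Covariant isometric representations and the generalized Toeplitz algebra -/

/-- Covariant isometric representations of `P ⋊ ℕ^×` in a unital C⋆-algebra. -/
structure IsCovariantRep {B : Type*} [CStarAlgebra B] (W : PN → B) : Prop where
  map_one : W 1 = 1
  isometry : ∀ x, star (W x) * W x = 1
  map_mul : ∀ x y, W (x * y) = W x * W y
  covariant_of_empty : ∀ x y : PN, x.translate ∩ y.translate = ∅ →
    W x * star (W x) * (W y * star (W y)) = 0
  covariant_of_nonempty : ∀ (x y : PN) (h : (x.translate ∩ y.translate).Nonempty),
    W x * star (W x) * (W y * star (W y)) = W (PN.cup x y h) * star (W (PN.cup x y h))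

/-- The generalized Toeplitz algebra `𝒯(P ⋊ ℕ^×)`: the universal C⋆-algebra for covariant
isometric representations of `P ⋊ ℕ^×`. -/
abbrev Toeplitz : Type 1 := UnivCStar.Alg fun (B : Type) [CStarAlgebra B] (W : PN → B) =>
  IsCovariantRep W

/-- The canonical covariant isometric representation. -/
def W : PN → Toeplitz := UnivCStar.gen _

/-! ## The C⋆-algebra `𝒜` given by generators and relations -/

/-- Isometries `s`, `t`, `v p` (`p` prime) that satisfy (R1), (R2) and (T1)-(T6). -/
structure SatisfiesRelations {A : Type*} [CStarAlgebra A] (s t : A) (v : Nat.Primes → A) :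
    Prop where
  isometry_s : star s * s = 1
  isometry_t : star t * t = 1
  isometry_v : ∀ p, star (v p) * v p = 1
  R1 : t ^ 2 = s ^ 3
  R2a : t * s = s * t
  R2b : star s * t = t * star s
  R2c : star t * s = s * star t
  T1a : ∀ p, v p * s = s ^ (p : ℕ) * v p
  T1b : ∀ p, v p * t = t ^ (p : ℕ) * v p
  T1c : ∀ p, v p * star s = star s ^ (p : ℕ) * v p
  T1d : ∀ p, v p * star t = star t ^ (p : ℕ) * v p
  T2 : ∀ p q, v p * v q = v q * v p
  T3 : ∀ p q, p ≠ q → star (v p) * v q = v q * star (v p)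
  T4 : ∀ p, star s * v p = s ^ ((p : ℕ) - 1) * v p * star s
  T5 : ∀ (p : Nat.Primes) (k₁ k₂ : ℕ), 1 ≤ 2 * k₁ + 3 * k₂ → 2 * k₁ + 3 * k₂ < p →
    star (v p) * s ^ k₁ * t ^ k₂ * v p = 0
  T6a : ∀ (p : Nat.Primes) (k : ℕ), (p : ℕ) ≠ 2 → 1 ≤ k → k < p → star (v p) * s ^ k * v p = 0
  T6b : ∀ p : Nat.Primes, (p : ℕ) = 2 → star (v p) * s * v p = t * star s
  T6c : ∀ (p : Nat.Primes) (k : ℕ), (p : ℕ) ≠ 3 → 1 ≤ k → k < p → star (v p) * t ^ k * v p = 0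
  T6d : ∀ p : Nat.Primes, (p : ℕ) = 3 → star (v p) * t * v p = t * star s
  T6e : ∀ p : Nat.Primes, (p : ℕ) = 3 → star (v p) * t ^ 2 * v p = s
  T6f : ∀ (p : Nat.Primes) (k : ℕ), 1 ≤ k → k < p → star (v p) * t ^ k * star s ^ k * v p = 0

/-- The generators of `𝒜`. -/
inductive Generator : Type
  | s : Generator
  | t : Generator
  | v : Nat.Primes → Generator

/-- The universal C⋆-algebra `𝒜` generated by isometries `s`, `t` and `v p` (`p` prime)
subject to (R1), (R2) and (T1)-(T6). -/
abbrev Presented : Type 1 := UnivCStar.Alg fun (B : Type) [CStarAlgebra B] (f : Generator → B) =>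
  SatisfiesRelations (f .s) (f .t) fun p => f (.v p)

namespace Presented

/-- The generator `s` of `𝒜`. -/
def s : Presented := UnivCStar.gen _ .s

/-- The generator `t` of `𝒜`. -/
def t : Presented := UnivCStar.gen _ .t

/-- The generators `v p` of `𝒜`. -/
def v (p : Nat.Primes) : Presented := UnivCStar.gen _ (.v p)

end Presented

/-! ## Both algebras have the universal properties that define them -/

theorem IsCovariantRep.of_jointly_injective {B : Type*} [CStarAlgebra B] {X : PN → B}
    {I : Type*} {C : I → Type*} [∀ i, CStarAlgebra (C i)] (φ : ∀ i, B →⋆ₐ[ℂ] C i)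
    (hφ : ∀ x y, (∀ i, φ i x = φ i y) → x = y) (h : ∀ i, IsCovariantRep fun x => φ i (X x)) :
    IsCovariantRep X where
  map_one := hφ _ _ fun i => by simpa [map_star] using (h i).map_one
  isometry x := hφ _ _ fun i => by simpa [map_star] using (h i).isometry x
  map_mul x y := hφ _ _ fun i => by simpa [map_star] using (h i).map_mul x y
  covariant_of_empty x y hxy := hφ _ _ fun i => by simpa [map_star] using (h i).covariant_of_empty x y hxy
  covariant_of_nonempty x y hxy := hφ _ _ fun i => by
    simpa [map_star] using (h i).covariant_of_nonempty x y hxy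

theorem SatisfiesRelations.of_jointly_injective {B : Type*} [CStarAlgebra B] {s t : B}
    {v : Nat.Primes → B} {I : Type*} {C : I → Type*} [∀ i, CStarAlgebra (C i)]
    (φ : ∀ i, B →⋆ₐ[ℂ] C i) (hφ : ∀ x y, (∀ i, φ i x = φ i y) → x = y)
    (h : ∀ i, SatisfiesRelations (φ i s) (φ i t) fun p => φ i (v p)) :
    SatisfiesRelations s t v where
  isometry_s := hφ _ _ fun i => by simpa [map_star] using (h i).isometry_s
  isometry_t := hφ _ _ fun i => by simpa [map_star] using (h i).isometry_t
  isometry_v p := hφ _ _ fun i => by simpa [map_star] using (h i).isometry_v p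
  R1 := hφ _ _ fun i => by simpa [map_star] using (h i).R1
  R2a := hφ _ _ fun i => by simpa [map_star] using (h i).R2a
  R2b := hφ _ _ fun i => by simpa [map_star] using (h i).R2b
  R2c := hφ _ _ fun i => by simpa [map_star] using (h i).R2c
  T1a p := hφ _ _ fun i => by simpa [map_star] using (h i).T1a p
  T1b p := hφ _ _ fun i => by simpa [map_star] using (h i).T1b p
  T1c p := hφ _ _ fun i => by simpa [map_star] using (h i).T1c p
  T1d p := hφ _ _ fun i => by simpa [map_star] using (h i).T1d p
  T2 p q := hφ _ _ fun i => by simpa [map_star] using (h i).T2 p q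
  T3 p q hpq := hφ _ _ fun i => by simpa [map_star] using (h i).T3 p q hpq
  T4 p := hφ _ _ fun i => by simpa [map_star] using (h i).T4 p
  T5 p k₁ k₂ h1 h2 := hφ _ _ fun i => by simpa [map_star] using (h i).T5 p k₁ k₂ h1 h2
  T6a p k h1 h2 h3 := hφ _ _ fun i => by simpa [map_star] using (h i).T6a p k h1 h2 h3
  T6b p hp := hφ _ _ fun i => by simpa [map_star] using (h i).T6b p hp
  T6c p k h1 h2 h3 := hφ _ _ fun i => by simpa [map_star] using (h i).T6c p k h1 h2 h3
  T6d p hp := hφ _ _ fun i => by simpa [map_star] using (h i).T6d p hp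
  T6e p hp := hφ _ _ fun i => by simpa [map_star] using (h i).T6e p hp
  T6f p k h1 h2 := hφ _ _ fun i => by simpa [map_star] using (h i).T6f p k h1 h2

/-- The canonical representation `W` is covariant. -/
theorem isCovariantRep_W : IsCovariantRep W :=
  IsCovariantRep.of_jointly_injective (UnivCStar.proj _) (UnivCStar.proj_jointly_injective _)
    fun i => i.sat

/-- The generators of `𝒜` satisfy the relations. -/
theorem satisfiesRelations_gen : SatisfiesRelations Presented.s Presented.t Presented.v :=
  SatisfiesRelations.of_jointly_injective (UnivCStar.proj _) (UnivCStar.proj_jointly_injective _)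
    fun i => i.sat

/-- Every covariant isometric representation, in a C⋆-algebra of any universe, factors uniquely
through `𝒯(P ⋊ ℕ^×)`. -/
theorem Toeplitz.existsUnique_hom {B : Type*} [CStarAlgebra B] {X : PN → B}
    (hX : IsCovariantRep X) : ∃! π : Toeplitz →⋆ₐ[ℂ] B, ∀ x, π (W x) = X x := by
  obtain ⟨π, hπ⟩ := UnivCStar.exists_hom
    (fun (B : Type) [CStarAlgebra B] (W : PN → B) => IsCovariantRep W) X hX.isometry
    fun C _ f φ hφ hf => IsCovariantRep.of_jointly_injective (fun _ : Unit => φ)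
      (fun x y h => hφ (h ())) fun _ => by simpa only [hf] using hX
  exact ⟨π, hπ, fun ψ hψ => UnivCStar.hom_ext _ fun x => (hψ x).trans (hπ x).symm⟩

/-- Every family of isometries, in a C⋆-algebra of any universe, that satisfies the relations is
the image of the generators of `𝒜` under a unique homomorphism. -/
theorem Presented.existsUnique_hom {B : Type*} [CStarAlgebra B] {s t : B} {v : Nat.Primes → B}
    (h : SatisfiesRelations s t v) : ∃! π : Presented →⋆ₐ[ℂ] B,
      π Presented.s = s ∧ π Presented.t = t ∧ ∀ p, π (Presented.v p) = v p := by
  obtain ⟨π, hπ⟩ := UnivCStar.exists_hom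
    (fun (B : Type) [CStarAlgebra B] (f : Generator → B) =>
      SatisfiesRelations (f .s) (f .t) fun p => f (.v p))
    (Generator.rec s t v : Generator → B)
    (by rintro (_ | _ | p); exacts [h.isometry_s, h.isometry_t, h.isometry_v p])
    fun C _ f φ hφ hf => SatisfiesRelations.of_jointly_injective (fun _ : Unit => φ)
      (fun x y h => hφ (h ())) fun _ => by simpa only [hf] using h
  refine ⟨π, ⟨hπ .s, hπ .t, fun p => hπ (.v p)⟩, fun ψ hψ => UnivCStar.hom_ext _ ?_⟩
  rintro (_ | _ | p)
  exacts [hψ.1.trans (hπ .s).symm, hψ.2.1.trans (hπ .t).symm, (hψ.2.2 p).trans (hπ (.v p)).symm]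

end PNToeplitz

end

namespace PNToeplitz

/-! ## A unitary square root of `s` -/

section UnitaryRoot

variable {R : Type*} [Monoid R] [StarMul R] {s t : R}

/-! The generators `s` and `t` are forced to be unitary. Since `t` commutes with `star s`, so does
`t ^ 2 = s ^ 3`, and cancelling the isometry `s ^ 2` gives `s * star s = 1`. Then `u = t * star s`
is a unitary with `u ^ 2 = s` and `u ^ 3 = t`, so the gap of `P` at 1 disappears. Both algebras thus
encode the same data, `IsAffinePair`: a unitary `u` and isometries `V a` satisfying relations of `ℤ
⋊ ℕ^×`.

From such a pair, (m, a) ↦ u^m V_a is covariant (`IsAffinePair.isCovariantRep`). Its range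
projections depend on m only modulo a, so a product of two of them either vanishes because gcd(a, b)
does not divide the difference of the translations, or both can be moved to a common translation,
where `range_mul_range` gives the lcm.

Conversely (`IsCovariantRep.satisfiesRelations`), covariance at (2,1), (3,1) yields the unitary, at
(0,p), (0,q) it yields T3, and at (0,p), (m,p) with p ∤ m it yields orthogonality; the remaining
relations are arithmetic of exponents of `u`. The two universal properties then give homomorphisms
that are mutually inverse on generators. -/

theorem mul_star_self_of_sq_eq_cube (hs : star s * s = 1) (h : t ^ 2 = s ^ 3)
    (hst : star s * t = t * star s) : s * star s = 1 := by
  have h1 : star s * s ^ 3 = s ^ 3 * star s := by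
    have hc : Commute (star s) (t ^ 2) := Commute.pow_right hst 2
    rw [← h]
    exact hc
  have h2 : s ^ 2 = s ^ 2 * (s * star s) := by
    calc s ^ 2 = star s * s * s ^ 2 := by rw [hs, one_mul]
      _ = star s * s ^ 3 := by rw [mul_assoc, pow_succ' s 2]
      _ = s ^ 2 * (s * star s) := by rw [h1, pow_succ s 2, mul_assoc]
  have h3 : star s ^ 2 * s ^ 2 = 1 := by
    rw [pow_two, pow_two, mul_assoc, ← mul_assoc (star s) s s, hs, one_mul, hs]
  calc s * star s = star s ^ 2 * s ^ 2 * (s * star s) := by rw [h3, one_mul]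
    _ = 1 := by rw [mul_assoc, ← h2, h3]

/-- Isometries `s`, `t` with `t² = s³` for which `t` commutes with `s` and `s⋆` are the second and
third powers of a unitary. -/
theorem exists_unitary_root (hs : star s * s = 1) (ht : star t * t = 1) (h : t ^ 2 = s ^ 3)
    (hts : t * s = s * t) (hst : star s * t = t * star s) :
    ∃ u : unitary R, (u : R) ^ 2 = s ∧ (u : R) ^ 3 = t ∧ (u : R) = t * star s := by
  have hs' := mul_star_self_of_sq_eq_cube hs h hst
  -- `t * star s ^ 3` is a right inverse of `t`, because `t ^ 2 = s ^ 3` and `s` is unitary; it must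
  -- equal the left inverse `star t`.
  have ht' : t * star t = 1 := by
    have h1 : t * (t * star s ^ 3) = 1 := by
      have hc : Commute s (star s) := hs'.trans hs.symm
      rw [← mul_assoc, ← pow_two, h, ← hc.mul_pow, hs', one_pow]
    rwa [left_inv_eq_right_inv ht h1]
  let S : unitary R := ⟨s, hs, hs'⟩
  let T : unitary R := ⟨t, ht, ht'⟩
  have hTS : Commute T S⁻¹ := Commute.inv_right (Subtype.ext hts : T * S = S * T)
  have hT2 : T ^ 2 = S ^ 3 := Subtype.ext h
  have h2 : (T * S⁻¹) ^ 2 = S := by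
    rw [hTS.mul_pow, hT2]
    group
  refine ⟨T * S⁻¹, congrArg Subtype.val h2, ?_, rfl⟩
  refine congrArg Subtype.val (?_ : (T * S⁻¹) ^ 3 = T)
  rw [pow_succ', h2]
  group

end UnitaryRoot

/-! ## Generators of `P ⋊ ℕ^×` -/

namespace PN

theorem two_pow (i : ℕ) : (two ^ i).fst = 2 * i ∧ (two ^ i).snd = 1 := by
  induction i with
  | zero => simp
  | succ i ih =>
    rw [pow_succ, mul_fst, mul_snd, ih.1, ih.2]
    exact ⟨by simp [two, mul_add], rfl⟩

theorem three_pow (i : ℕ) : (three ^ i).fst = 3 * i ∧ (three ^ i).snd = 1 := by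
  induction i with
  | zero => simp
  | succ i ih =>
    rw [pow_succ, mul_fst, mul_snd, ih.1, ih.2]
    exact ⟨by simp [three, mul_add], rfl⟩

theorem eq_two_pow_mul_three_pow {m : ℕ} (hm : m ∈ P) :
    ∃ i j, m = 2 * i + 3 * j ∧ (⟨m, 1, hm⟩ : PN) = two ^ i * three ^ j := by
  obtain ⟨i, j, h⟩ : ∃ i j, m = 2 * i + 3 * j := by
    rcases Nat.even_or_odd' m with ⟨c, h | h⟩
    · exact ⟨c, 0, by omega⟩
    · rw [mem_P] at hm
      -- Here m = 2c + 1 with m ≠ 1, so c ≥ 1 and the truncated subtraction is exact.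
      exact ⟨c - 1, 1, by omega⟩
  refine ⟨i, j, h, PN.ext ?_ ?_⟩
  · simp [two_pow, three_pow, h]
  · simp [two_pow, three_pow]

/-- The element `(0, a)`. -/
def dilation (a : ℕ+) : PN := ⟨0, a, P.zero_mem⟩

theorem dilation_mul (a b : ℕ+) : dilation (a * b) = dilation a * dilation b := by
  ext <;> simp [dilation]

theorem eq_translation_mul_dilation (x : PN) : x = ⟨x.fst, 1, x.fst_mem⟩ * dilation x.snd := by
  ext <;> simp [dilation]

/-- A homomorphism on `P ⋊ ℕ^×` is determined by its values on `(2, 1)`, `(3, 1)` and `(0, p)`. -/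
theorem hom_ext {M : Type*} [Monoid M] {f g : PN →* M} (h2 : f two = g two)
    (h3 : f three = g three) (hp : ∀ p, f (prime p) = g (prime p)) : f = g := by
  have hd : ∀ n (hn : 0 < n), f (dilation ⟨n, hn⟩) = g (dilation ⟨n, hn⟩) := by
    intro n
    induction n using induction_on_primes with
    | zero => exact fun h => absurd h (lt_irrefl 0)
    | one =>
      intro _
      exact (map_one f).trans (map_one g).symm
    | prime_mul p a hpp ih =>
      intro hn
      have ha : 0 < a := Nat.pos_of_mul_pos_left hn
      have : dilation ⟨p * a, hn⟩ = prime ⟨p, hpp⟩ * dilation ⟨a, ha⟩ :=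
        dilation_mul ⟨p, hpp.pos⟩ ⟨a, ha⟩
      rw [this, map_mul, map_mul, ih ha]
      exact congrArg (· * _) (hp ⟨p, hpp⟩)
  refine MonoidHom.ext fun x => ?_
  obtain ⟨i, j, -, hij⟩ := eq_two_pow_mul_three_pow x.fst_mem
  rw [eq_translation_mul_dilation x, hij]
  simp only [map_mul, map_pow, h2, h3]
  exact congrArg _ (hd _ _)

/-- The Chinese remainder theorem solves the two congruences. Adding a large multiple of the product
of the moduli makes both quotients at least 2, which puts them in `P`; this is the role of the
summand 2 in the multiplier. -/
theorem exists_mem_translate_inter {x y : PN}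
    (h : (Nat.gcd x.snd y.snd : ℤ) ∣ (y.fst : ℤ) - x.fst) :
    (x.translate ∩ y.translate).Nonempty := by
  have hxy : x.fst ≡ y.fst [MOD Nat.gcd x.snd y.snd] := (Nat.modEq_iff_dvd).2 h
  obtain ⟨k, hkx, hky⟩ := Nat.chineseRemainder' hxy
  have key : ∀ z : PN, k ≡ z.fst [MOD z.snd] → (z.snd : ℕ) ∣ x.snd * y.snd →
      z.fst ≤ x.fst + y.fst → k + x.snd * y.snd * (x.fst + y.fst + 2) ∈ z.translate := by
    intro z hz hd hle
    obtain ⟨c, hc⟩ := hd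
    have hz0 : 0 < (z.snd : ℕ) := z.snd.pos
    have hc0 : 0 < c := by
      have : 0 < (x.snd : ℕ) * y.snd := Nat.mul_pos x.snd.pos y.snd.pos
      rw [hc] at this
      exact Nat.pos_of_mul_pos_left this
    obtain ⟨j, hj⟩ := (Nat.modEq_iff_dvd).1 hz.symm
    have hlow : (z.snd : ℤ) * (-(z.fst : ℤ)) ≤ z.snd * j := by
      rw [← hj]
      have : (1 : ℤ) ≤ z.snd := by exact_mod_cast hz0
      nlinarith [Int.natCast_nonneg z.fst, Int.natCast_nonneg k]
    have hj' : -(z.fst : ℤ) ≤ j := le_of_mul_le_mul_left hlow (by exact_mod_cast hz0)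
    have hbig : ((x.fst : ℤ) + y.fst + 2) ≤ c * (x.fst + y.fst + 2) := by
      have : (1 : ℤ) ≤ c := by exact_mod_cast hc0
      nlinarith [Int.natCast_nonneg x.fst, Int.natCast_nonneg y.fst]
    have hle' : (z.fst : ℤ) ≤ x.fst + y.fst := by exact_mod_cast hle
    obtain ⟨i, hi⟩ := Int.eq_ofNat_of_zero_le
      (show 0 ≤ j + c * ((x.fst : ℤ) + y.fst + 2) by linarith)
    refine ⟨i, ?_, ?_⟩
    · rw [mem_P]
      omega
    · rw [hc]
      zify
      rw [← hi]
      linear_combination hj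
  exact ⟨_, key x hkx (Dvd.intro _ rfl) (by omega), key y hky (Dvd.intro_left _ rfl) (by omega)⟩

end PN

/-! ## Isometries that dilate a unitary -/

/-- A unitary `u` and isometries `V a`, multiplicative in `a ≥ 1`, that satisfy the relations of
the affine semigroup `ℤ ⋊ ℕ^×`. -/
structure IsAffinePair {B : Type*} [Ring B] [StarRing B] (u : unitary B) (V : ℕ → B) : Prop where
  map_one : V 1 = 1
  map_mul : ∀ {a b : ℕ}, a ≠ 0 → b ≠ 0 → V (a * b) = V a * V b
  isometry : ∀ a, star (V a) * V a = 1
  shift : ∀ {a : ℕ}, a ≠ 0 → ∀ k : ℤ, V a * ↑(u ^ k) = ↑(u ^ (a * k)) * V a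
  orthogonal : ∀ {p : ℕ}, p.Prime → ∀ k : ℤ, ¬ (p : ℤ) ∣ k → star (V p) * ↑(u ^ k) * V p = 0
  star_commute : ∀ {p q : ℕ}, p.Prime → q.Prime → p ≠ q → Commute (star (V p)) (V q)

namespace IsAffinePair

variable {B : Type*} [Ring B] [StarRing B] {u : unitary B} {V : ℕ → B} (h : IsAffinePair u V)
include h

/-- Induction over the prime factors of each index in turn; by coprimality only distinct primes
meet. -/
theorem star_commute_of_coprime {a b : ℕ} (hab : Nat.Coprime a b) (ha : a ≠ 0) (hb : b ≠ 0) :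
    Commute (star (V a)) (V b) := by
  have h1 : ∀ p, p.Prime → ∀ b, b ≠ 0 → Nat.Coprime p b → Commute (star (V p)) (V b) := by
    intro p hp b
    induction b using induction_on_primes with
    | zero => simp
    | one => simp [h.map_one]
    | prime_mul q c hq ih =>
      intro hc hpc
      have hc' : c ≠ 0 := right_ne_zero_of_mul hc
      rw [h.map_mul hq.ne_zero hc']
      refine Commute.mul_right (h.star_commute hp hq ?_)
        (ih hc' (Nat.Coprime.coprime_mul_left_right hpc))
      exact (Nat.coprime_primes hp hq).1 (Nat.Coprime.coprime_mul_right_right hpc)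
  induction a using induction_on_primes with
  | zero => simp at ha
  | one => simp [h.map_one]
  | prime_mul p c hp ih =>
    have hc' : c ≠ 0 := right_ne_zero_of_mul ha
    rw [h.map_mul hp.ne_zero hc', star_mul]
    exact Commute.mul_left (ih (Nat.Coprime.coprime_mul_left hab) hc')
      (h1 p hp b hb (Nat.Coprime.coprime_mul_right hab))

/-- Peel a prime p off d. If p ∤ k, the inner compression already vanishes; if k = pj, the shift
relation turns it into u^j, and the claim descends to d / p and j. -/
theorem star_mul_mul_eq_zero {d : ℕ} (hd : d ≠ 0) (k : ℤ) (hk : ¬ (d : ℤ) ∣ k) :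
    star (V d) * ↑(u ^ k) * V d = 0 := by
  induction d using induction_on_primes generalizing k with
  | zero => simp at hd
  | one => simp at hk
  | prime_mul p c hp ih =>
    have hc : c ≠ 0 := right_ne_zero_of_mul hd
    have hfac : star (V (p * c)) * ↑(u ^ k) * V (p * c)
        = star (V c) * (star (V p) * ↑(u ^ k) * V p) * V c := by
      rw [h.map_mul hp.ne_zero hc, star_mul]
      simp only [mul_assoc]
    rw [hfac]
    by_cases hpk : (p : ℤ) ∣ k
    · obtain ⟨j, rfl⟩ := hpk
      rw [mul_assoc (star (V p)), ← h.shift hp.ne_zero, ← mul_assoc (star (V p)), h.isometry,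
        one_mul]
      refine ih hc j fun hj => hk ?_
      push_cast
      exact mul_dvd_mul_left _ hj
    · rw [h.orthogonal hp k hpk, mul_zero, zero_mul]

/-- Both isometries factor through V of the gcd, so the compression by that common factor sits in
the middle. -/
theorem star_mul_mul_eq_zero_of_gcd {a b : ℕ} (ha : a ≠ 0) (hb : b ≠ 0) (k : ℤ)
    (hk : ¬ (Nat.gcd a b : ℤ) ∣ k) : star (V a) * ↑(u ^ k) * V b = 0 := by
  have hd : Nat.gcd a b ≠ 0 := Nat.gcd_ne_zero_left ha
  obtain ⟨a', ha'⟩ := Nat.gcd_dvd_left a b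
  obtain ⟨b', hb'⟩ := Nat.gcd_dvd_right a b
  have hVa : V a = V (Nat.gcd a b) * V a' := by
    rw [← h.map_mul hd (right_ne_zero_of_mul (ha' ▸ ha)), ← ha']
  have hVb : V b = V (Nat.gcd a b) * V b' := by
    rw [← h.map_mul hd (right_ne_zero_of_mul (hb' ▸ hb)), ← hb']
  calc star (V a) * ↑(u ^ k) * V b
      = star (V a') * (star (V (Nat.gcd a b)) * ↑(u ^ k) * V (Nat.gcd a b)) * V b' := by
        rw [hVb]
        nth_rw 1 [hVa]
        simp only [star_mul, mul_assoc]
    _ = 0 := by rw [h.star_mul_mul_eq_zero hd k hk, mul_zero, zero_mul]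

/-- With a = a'g, b = b'g and a', b' coprime, the factor V_g cancels in V_a⋆ V_b, leaving V_{a'}⋆
V_{b'} = V_{b'} V_{a'}⋆; the outer factors then combine to index a'b'g, the lcm. -/
theorem range_mul_range {a b : ℕ} (ha : a ≠ 0) (hb : b ≠ 0) :
    V a * star (V a) * (V b * star (V b)) = V (Nat.lcm a b) * star (V (Nat.lcm a b)) := by
  obtain ⟨g, a', b', hg, hco, rfl, rfl⟩ := Nat.exists_coprime' (m := a) (n := b)
    (Nat.gcd_pos_of_pos_left _ (Nat.pos_of_ne_zero ha))
  have ha' : a' ≠ 0 := left_ne_zero_of_mul ha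
  have hb' : b' ≠ 0 := left_ne_zero_of_mul hb
  have hg' : g ≠ 0 := hg.ne'
  have hlcm : Nat.lcm (a' * g) (b' * g) = a' * b' * g := by
    rw [Nat.lcm_mul_right, hco.lcm_eq_mul]
  have hcomm : star (V (a' * g)) * V (b' * g) = V b' * star (V a') := by
    rw [mul_comm a', mul_comm b', h.map_mul hg' ha', h.map_mul hg' hb', star_mul, mul_assoc,
      ← mul_assoc (star (V g)), h.isometry, one_mul]
    exact h.star_commute_of_coprime hco ha' hb'
  calc V (a' * g) * star (V (a' * g)) * (V (b' * g) * star (V (b' * g)))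
      = V (a' * g) * (star (V (a' * g)) * V (b' * g)) * star (V (b' * g)) := by
        simp only [mul_assoc]
    _ = V (a' * g) * V b' * star (V (b' * g) * V a') := by
        rw [hcomm, star_mul]
        simp only [mul_assoc]
    _ = _ := by
        rw [← h.map_mul ha hb', ← h.map_mul hb ha', hlcm, mul_right_comm a', mul_right_comm b',
          mul_comm b']

/-- The range projection of the isometry attached to `(m, a)` depends on `m` only modulo `a`. -/
theorem range_eq_of_dvd_sub {a : ℕ} (ha : a ≠ 0) {m l : ℤ} (hml : (a : ℤ) ∣ m - l) :
    ↑(u ^ m) * V a * star (↑(u ^ m) * V a) = ↑(u ^ l) * (V a * star (V a)) * star (↑(u ^ l) : B) := by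
  obtain ⟨k, hk⟩ := hml
  -- Moved to the right of `V a`, the excess u^{ak} becomes the unitary u^k, which drops out of the
  -- range projection.
  have : (↑(u ^ m) : B) * V a = ↑(u ^ l) * V a * ↑(u ^ k) := by
    rw [mul_assoc, h.shift ha, ← mul_assoc, ← Submonoid.coe_mul, ← zpow_add, ← hk,
      add_sub_cancel]
  have hk1 : (↑(u ^ k) : B) * star (↑(u ^ k) : B) = 1 := (u ^ k).2.2
  rw [this, star_mul, mul_assoc, ← mul_assoc (↑(u ^ k) : B), hk1, one_mul, star_mul]
  simp only [mul_assoc]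

end IsAffinePair

/-! ### Intertwining and commutation identities -/

section Semiconj

variable {R : Type*} [Monoid R] [StarMul R]

/-- Semiconjugation passes to products and to inverses of units, hence to u = u³ u⁻² and to all its
integer powers. -/
theorem mul_zpow_of_sq_of_cube {u : unitary R} {v : R} {p : ℕ}
    (h2 : v * (u : R) ^ 2 = ((u : R) ^ 2) ^ p * v) (h3 : v * (u : R) ^ 3 = ((u : R) ^ 3) ^ p * v)
    (k : ℤ) : v * ↑(u ^ k) = ↑(u ^ (p * k)) * v := by
  let w : Rˣ := Unitary.toUnits u
  have hw : ∀ n : ℤ, ((w ^ n : Rˣ) : R) = ↑(u ^ n) := fun n => by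
    rw [← map_zpow]
    rfl
  have H2 : SemiconjBy v ↑(w ^ 2) ↑((w ^ 2) ^ p) := h2
  have H3 : SemiconjBy v ↑(w ^ 3) ↑((w ^ 3) ^ p) := h3
  have H1 : SemiconjBy v ↑w ↑(w ^ p) := by
    have := H3.mul_right H2.units_inv_right
    rw [← Units.val_mul, ← Units.val_mul] at this
    rwa [show w ^ 3 * (w ^ 2)⁻¹ = w by group,
      show (w ^ 3) ^ p * ((w ^ 2) ^ p)⁻¹ = w ^ p by
        rw [← pow_mul, ← pow_mul, mul_inv_eq_iff_eq_mul, ← pow_add]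
        congr 1
        ring] at this
  have := H1.units_zpow_right k
  rw [← zpow_natCast, ← zpow_mul, hw, hw] at this
  exact this

/-- Compressing the covariance identity by x⋆ on the left and y on the right removes the
projections. It applies whenever x ⋓ y is the product xy. -/
theorem star_mul_comm_of_range_mul_range {x y : R} (hx : star x * x = 1) (hy : star y * y = 1)
    (hxy : x * y = y * x) (h : x * star x * (y * star y) = x * y * star (x * y)) :
    star x * y = y * star x := by
  calc star x * y = star x * x * (star x * y) * (star y * y) := by rw [hx, hy, one_mul, mul_one]
    _ = star x * (x * star x * (y * star y)) * y := by simp only [mul_assoc]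
    _ = star x * x * y * (star x * (star y * y)) := by
      rw [h]
      -- Only the product under the adjoint is commuted, so that `star y` meets the final `y`.
      nth_rw 2 [hxy]
      rw [star_mul]
      simp only [mul_assoc]
    _ = y * star x := by rw [hx, hy, one_mul, mul_one]

end Semiconj

/-- Only the exponent modulo p matters for the vanishing of such a compression, since u^q is
invertible. -/
theorem star_mul_zpow_mul_eq_of_shift {R : Type*} [Monoid R] [StarMul R] {u : unitary R} {v : R}
    {p : ℕ} (h : ∀ k : ℤ, v * ↑(u ^ k) = ↑(u ^ (p * k)) * v) (r q : ℤ) :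
    star v * ↑(u ^ (r + p * q)) * v = star v * ↑(u ^ r) * v * ↑(u ^ q) := by
  rw [mul_assoc _ v, h, zpow_add, Submonoid.coe_mul]
  simp only [mul_assoc]

/-! ## From the relations to a covariant representation -/

/-- The product of the `v p` over the prime factors `p` of `n`, with multiplicity. -/
def primeProd {M : Type*} [Monoid M] (v : Nat.Primes → M) (n : ℕ) : M :=
  (n.primeFactorsList.map fun p => if hp : p.Prime then v ⟨p, hp⟩ else 1).prod

section PrimeProd

variable {M : Type*} [Monoid M] {v : Nat.Primes → M}

theorem primeProd_zero : primeProd v 0 = 1 := by simp [primeProd]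

theorem primeProd_one : primeProd v 1 = 1 := by simp [primeProd]

theorem primeProd_prime (p : Nat.Primes) : primeProd v p = v p := by
  simp only [primeProd, Nat.primeFactorsList_prime p.2, List.map_cons, List.map_nil,
    List.prod_singleton]
  exact dif_pos p.2

/-- The prime factor list of a product is a permutation of the concatenated lists, and the factors
commute. -/
theorem primeProd_mul (hv : ∀ p q, v p * v q = v q * v p) {a b : ℕ} (ha : a ≠ 0) (hb : b ≠ 0) :
    primeProd v (a * b) = primeProd v a * primeProd v b := by
  unfold primeProd
  rw [← List.prod_append, ← List.map_append]
  refine ((Nat.perm_primeFactorsList_mul ha hb).map _).prod_eq' ?_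
  rw [List.pairwise_map]
  refine List.pairwise_of_forall fun p q => ?_
  split_ifs
  · exact hv _ _
  · exact Commute.one_right _
  · exact Commute.one_left _
  · exact Commute.one_left _

end PrimeProd

theorem SatisfiesRelations.exists_isAffinePair {A : Type*} [CStarAlgebra A] {s t : A}
    {v : Nat.Primes → A} (h : SatisfiesRelations s t v) :
    ∃ u : unitary A, (u : A) ^ 2 = s ∧ (u : A) ^ 3 = t ∧ IsAffinePair u (primeProd v) := by
  obtain ⟨u, hs, ht, hu⟩ :=
    exists_unitary_root h.isometry_s h.isometry_t h.R1 h.R2a h.R2b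
  have hshift : ∀ (p : Nat.Primes) (k : ℤ), v p * ↑(u ^ k) = ↑(u ^ (p * k)) * v p := fun p =>
    mul_zpow_of_sq_of_cube (by rw [hs, h.T1a]) (by rw [ht, h.T1b])
  refine ⟨u, hs, ht, primeProd_one, primeProd_mul h.T2, fun a => ?_, fun {a} => ?_,
    fun {p} hp k hk => ?_, fun {p q} hp hq hpq => ?_⟩
  · induction a using induction_on_primes with
    | zero => simp [primeProd_zero]
    | one => simp [primeProd_one]
    | prime_mul p c hp ih =>
      -- Multiplicativity excludes index 0, where `primeProd` is the empty product 1.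
      rcases eq_or_ne c 0 with rfl | hc
      · simp [primeProd_zero]
      · obtain ⟨p, rfl⟩ : ∃ P : Nat.Primes, (P : ℕ) = p := ⟨⟨p, hp⟩, rfl⟩
        rw [primeProd_mul h.T2 hp.ne_zero hc, primeProd_prime, star_mul, mul_assoc,
          ← mul_assoc (star (v _)), h.isometry_v, one_mul, ih]
  · induction a using induction_on_primes with
    | zero => simp
    | one => simp [primeProd_one]
    | prime_mul p c hp ih =>
      intro hpc k
      have hc : c ≠ 0 := right_ne_zero_of_mul hpc
      obtain ⟨p, rfl⟩ : ∃ P : Nat.Primes, (P : ℕ) = p := ⟨⟨p, hp⟩, rfl⟩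
      rw [primeProd_mul h.T2 hp.ne_zero hc, primeProd_prime, mul_assoc, ih hc, ← mul_assoc,
        hshift, mul_assoc]
      simp only [Nat.cast_mul, mul_assoc]
  · obtain ⟨p, rfl⟩ : ∃ P : Nat.Primes, (P : ℕ) = p := ⟨⟨p, hp⟩, rfl⟩
    rw [primeProd_prime]
    have hp0 : (p : ℤ) ≠ 0 := by exact_mod_cast hp.ne_zero
    obtain ⟨r, hr⟩ := Int.eq_ofNat_of_zero_le (Int.emod_nonneg k hp0)
    have hrp : r < p := by
      have := Int.emod_lt_of_pos k (show (0 : ℤ) < p by exact_mod_cast hp.pos)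
      omega
    have hr1 : 1 ≤ r := by
      have : k % p ≠ 0 := fun h0 => hk (Int.dvd_of_emod_eq_zero h0)
      omega
    -- Since `t ^ r * star s ^ r` is u^r, T6f is exactly orthogonality for the remainder r of k
    -- modulo p.
    have hcomm : Commute t (star s) := h.R2b.symm
    have := star_mul_zpow_mul_eq_of_shift (hshift p) r (k / p)
    rw [show (r : ℤ) + p * (k / p) = k by
      rw [← hr, Int.emod_add_mul_ediv]] at this
    rw [this, zpow_natCast, SubmonoidClass.coe_pow, hu, hcomm.mul_pow, ← mul_assoc,
      h.T6f p r hr1 hrp, zero_mul]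
  · obtain ⟨p, rfl⟩ : ∃ P : Nat.Primes, (P : ℕ) = p := ⟨⟨p, hp⟩, rfl⟩
    obtain ⟨q, rfl⟩ : ∃ Q : Nat.Primes, (Q : ℕ) = q := ⟨⟨q, hq⟩, rfl⟩
    rw [primeProd_prime, primeProd_prime]
    exact h.T3 _ _ fun he => hpq (congrArg Subtype.val he)

/-- The representation of `P ⋊ ℕ^×` given by a unitary and isometries that dilate it. -/
theorem IsAffinePair.isCovariantRep {A : Type*} [CStarAlgebra A] {u : unitary A} {V : ℕ → A}
    (h : IsAffinePair u V) : IsCovariantRep fun x : PN => ↑(u ^ (x.fst : ℤ)) * V x.snd where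
  map_one := by simp [h.map_one]
  isometry x := by
    have hk : star (↑(u ^ (x.fst : ℤ)) : A) * ↑(u ^ (x.fst : ℤ)) = 1 := (u ^ (x.fst : ℤ)).2.1
    rw [star_mul, mul_assoc, ← mul_assoc (star (↑(u ^ (x.fst : ℤ)) : A)), hk, one_mul, h.isometry]
  map_mul x y := by
    simp only [PN.mul_fst, PN.mul_snd, PNat.mul_coe, Nat.cast_add, Nat.cast_mul]
    rw [h.map_mul x.snd.ne_zero y.snd.ne_zero, zpow_add, Submonoid.coe_mul, mul_assoc,
      ← mul_assoc _ (V x.snd), ← h.shift x.snd.ne_zero]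
    simp only [mul_assoc]
  covariant_of_empty x y hxy := by
    have hk : ¬ (Nat.gcd x.snd y.snd : ℤ) ∣ -(x.fst : ℤ) + y.fst := fun hd =>
      (PN.exists_mem_translate_inter (by rwa [neg_add_eq_sub] at hd)).ne_empty hxy
    have h0 := h.star_mul_mul_eq_zero_of_gcd x.snd.ne_zero y.snd.ne_zero _ hk
    have hu : (↑(u ^ (-(x.fst : ℤ) + y.fst)) : A)
        = star (↑(u ^ (x.fst : ℤ)) : A) * ↑(u ^ (y.fst : ℤ)) := by
      rw [zpow_add, zpow_neg]
      rfl
    rw [hu] at h0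
    calc _ = ↑(u ^ (x.fst : ℤ)) * V x.snd *
          (star (V x.snd) * (star (↑(u ^ (x.fst : ℤ)) : A) * ↑(u ^ (y.fst : ℤ))) * V y.snd) *
          star (↑(u ^ (y.fst : ℤ)) * V y.snd) := by
          simp only [star_mul, mul_assoc]
      _ = 0 := by rw [h0, mul_zero, zero_mul]
  covariant_of_nonempty x y hxy := by
    -- The argument uses only that l lies in both translates, hence in both residue classes; its
    -- minimality plays no role.
    obtain ⟨⟨i, -, hi⟩, j, -, hj⟩ := Nat.sInf_mem hxy
    set l := sInf (x.translate ∩ y.translate) with hl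
    have hcup : (PN.cup x y hxy).fst = l := rfl
    have hx : ((x.snd : ℕ) : ℤ) ∣ (x.fst : ℤ) - l := ⟨-i, by rw [hi]; push_cast; ring⟩
    have hy : ((y.snd : ℕ) : ℤ) ∣ (y.fst : ℤ) - l := ⟨-j, by rw [hj]; push_cast; ring⟩
    have hk : star (↑(u ^ (l : ℤ)) : A) * ↑(u ^ (l : ℤ)) = 1 := (u ^ (l : ℤ)).2.1
    rw [h.range_eq_of_dvd_sub x.snd.ne_zero hx, h.range_eq_of_dvd_sub y.snd.ne_zero hy, hcup,
      show ((PN.cup x y hxy).snd : ℕ) = Nat.lcm x.snd y.snd from rfl, star_mul,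
      mul_assoc (↑(u ^ (l : ℤ)) : A) (V _), ← mul_assoc (V (Nat.lcm _ _)),
      ← h.range_mul_range x.snd.ne_zero y.snd.ne_zero]
    simp only [mul_assoc]
    rw [← mul_assoc (star (↑(u ^ (l : ℤ)) : A)), hk, one_mul]

/-! ## From a covariant representation to the relations -/

namespace PN

/-- Because 1 ∉ `P`, 3 is missing from 2 + `P` and 4 from 3 + `P`. The least common element is
therefore 2 + 3, so (2,1) ⋓ (3,1) is the product. -/
theorem five_isLeast : IsLeast (two.translate ∩ three.translate) 5 := by
  refine ⟨⟨⟨3, by simp [mem_P], rfl⟩, 2, by simp [mem_P], rfl⟩, ?_⟩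
  rintro k ⟨⟨m, hm, h1⟩, n, hn, h2⟩
  simp only [two, three, PNat.one_coe, one_mul, mem_P] at h1 h2 hm hn
  omega

theorem cup_two_three (h : (two.translate ∩ three.translate).Nonempty) :
    cup two three h = two * three :=
  PN.ext five_isLeast.csInf_eq rfl

theorem zero_mem_translate_prime (p : Nat.Primes) : 0 ∈ (prime p).translate :=
  ⟨0, P.zero_mem, rfl⟩

theorem cup_prime_prime {p q : Nat.Primes} (hpq : p ≠ q)
    (h : ((prime p).translate ∩ (prime q).translate).Nonempty) :
    cup (prime p) (prime q) h = prime p * prime q := by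
  refine PN.ext ?_ (PNat.eq ?_)
  · exact Nat.sInf_eq_zero.2 (.inl ⟨zero_mem_translate_prime p, zero_mem_translate_prime q⟩)
  · exact Nat.Coprime.lcm_eq_mul ((Nat.coprime_primes p.2 q.2).2 (Subtype.coe_injective.ne hpq))

theorem prime_mul_comm (p q : Nat.Primes) : prime p * prime q = prime q * prime p :=
  PN.ext rfl (mul_comm _ _)

theorem two_mul_three : two * three = three * two := rfl

theorem three_sq : three ^ 2 = two ^ 3 := by
  refine PN.ext ?_ ?_
  · rw [(three_pow 2).1, (two_pow 3).1]
  · rw [(three_pow 2).2, (two_pow 3).2]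

theorem prime_mul_two (p : Nat.Primes) : prime p * two = two ^ (p : ℕ) * prime p := by
  refine PN.ext ?_ ?_
  · rw [mul_fst, mul_fst, (two_pow _).1, (two_pow _).2]
    simp [prime, two, mul_comm]
  · rw [mul_snd, mul_snd, (two_pow _).2]
    exact mul_comm _ _

theorem prime_mul_three (p : Nat.Primes) : prime p * three = three ^ (p : ℕ) * prime p := by
  refine PN.ext ?_ ?_
  · rw [mul_fst, mul_fst, (three_pow _).1, (three_pow _).2]
    simp [prime, three, mul_comm]
  · rw [mul_snd, mul_snd, (three_pow _).2]
    exact mul_comm _ _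

theorem translate_inter_eq_empty (p : Nat.Primes) {m : ℕ} (hm : m ∈ P) (hpm : ¬ (p : ℕ) ∣ m) :
    (prime p).translate ∩ (⟨m, 1, hm⟩ * prime p : PN).translate = ∅ := by
  refine Set.eq_empty_of_forall_notMem ?_
  rintro k ⟨⟨i, -, hi⟩, j, -, hj⟩
  have hi' : k = p * i := hi.trans (zero_add _)
  have hj' : k = m + p * j := by
    rw [hj, mul_fst, mul_snd, one_mul]
    exact congrArg (m + · + _) (mul_zero _)
  exact hpm ((Nat.dvd_add_left ⟨j, rfl⟩).1 (hj' ▸ ⟨i, hi'⟩))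

end PN

/-- A covariant representation, as a homomorphism of monoids. -/
def IsCovariantRep.toMonoidHom {B : Type*} [CStarAlgebra B] {X : PN → B} (h : IsCovariantRep X) :
    PN →* B where
  toFun := X
  map_one' := h.map_one
  map_mul' := h.map_mul

section

variable {B : Type*} [CStarAlgebra B] {X : PN → B} (h : IsCovariantRep X)
include h

open PN

theorem IsCovariantRep.map_pow (x : PN) (n : ℕ) : X (x ^ n) = X x ^ n :=
  _root_.map_pow h.toMonoidHom x n

theorem IsCovariantRep.star_mul_eq_zero {x y : PN} (hxy : x.translate ∩ y.translate = ∅) :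
    star (X x) * X y = 0 := by
  calc star (X x) * X y
      = star (X x) * X x * (star (X x) * X y) * (star (X y) * X y) := by
        rw [h.isometry, h.isometry, one_mul, mul_one]
    _ = star (X x) * (X x * star (X x) * (X y * star (X y))) * X y := by simp only [mul_assoc]
    _ = 0 := by rw [h.covariant_of_empty x y hxy, mul_zero, zero_mul]

theorem IsCovariantRep.satisfiesRelations :
    SatisfiesRelations (X two) (X three) fun p => X (prime p) := by
  have hR2b : star (X two) * X three = X three * star (X two) := by
    refine star_mul_comm_of_range_mul_range (h.isometry _) (h.isometry _) ?_ ?_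
    · rw [← h.map_mul, ← h.map_mul, two_mul_three]
    · have hne : (two.translate ∩ three.translate).Nonempty := ⟨5, five_isLeast.1⟩
      rw [h.covariant_of_nonempty two three hne, cup_two_three, h.map_mul]
  have hR1 : X three ^ 2 = X two ^ 3 := by rw [← h.map_pow, ← h.map_pow, three_sq]
  have hR2a : X three * X two = X two * X three := by
    rw [← h.map_mul, ← h.map_mul, two_mul_three]
  have hT1a : ∀ p, X (prime p) * X two = X two ^ (p : ℕ) * X (prime p) := fun p => by
    rw [← h.map_pow, ← h.map_mul, ← h.map_mul, prime_mul_two]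
  have hT1b : ∀ p, X (prime p) * X three = X three ^ (p : ℕ) * X (prime p) := fun p => by
    rw [← h.map_pow, ← h.map_mul, ← h.map_mul, prime_mul_three]
  obtain ⟨u, hs, ht, hu⟩ :=
    exists_unitary_root (h.isometry two) (h.isometry three) hR1 hR2a hR2b
  have hshift : ∀ (p : Nat.Primes) (k : ℤ),
      X (prime p) * ↑(u ^ k) = ↑(u ^ (p * k)) * X (prime p) := fun p =>
    mul_zpow_of_sq_of_cube (by rw [hs, hT1a]) (by rw [ht, hT1b])
  have hnat : ∀ (m : ℕ) (hm : m ∈ P), X ⟨m, 1, hm⟩ = (u : B) ^ m := by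
    intro m hm
    obtain ⟨i, j, hij, he⟩ := eq_two_pow_mul_three_pow hm
    rw [he, h.map_mul, h.map_pow, h.map_pow, ← hs, ← ht, ← pow_mul, ← pow_mul, ← pow_add, hij]
  have hzero : ∀ (p : Nat.Primes) (k : ℕ), ¬ (p : ℕ) ∣ k →
      star (X (prime p)) * (u : B) ^ k * X (prime p) = 0 := by
    intro p k hk
    -- The exponent k may be 1, which is not in `P`. Adding 2p keeps its residue modulo p and lands
    -- in `P`; the resulting factor u² is cancelled afterwards.
    have hkP : k + 2 * p ∈ P := by
      have := p.2.two_le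
      rw [mem_P]
      omega
    have hkp : ¬ (p : ℕ) ∣ k + 2 * p := by
      rwa [Nat.dvd_add_left (Dvd.intro_left 2 rfl)]
    have h0 := h.star_mul_eq_zero (translate_inter_eq_empty p hkP hkp)
    have h1 := star_mul_zpow_mul_eq_of_shift (hshift p) k 2
    rw [h.map_mul, hnat, ← mul_assoc] at h0
    have h2 : (↑(u ^ ((k : ℤ) + p * 2)) : B) = (u : B) ^ (k + 2 * (p : ℕ)) := by
      rw [← SubmonoidClass.coe_pow, ← zpow_natCast]
      push_cast
      rw [mul_comm (p : ℤ)]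
    rw [h2, h0, zpow_natCast, SubmonoidClass.coe_pow] at h1
    calc star (X (prime p)) * (u : B) ^ k * X (prime p)
        = star (X (prime p)) * (u : B) ^ k * X (prime p) * (↑(u ^ (2 : ℤ)) *
          star (↑(u ^ (2 : ℤ)) : B)) := by rw [(u ^ (2 : ℤ)).2.2, mul_one]
      _ = 0 := by rw [← mul_assoc, ← h1, zero_mul]
  -- This is the source of the exceptional values in T6: p = 2 or 3 with k = 1 gives u = ts⋆, and p
  -- = 3 with k = 2 gives u² = s.
  have hcancel : ∀ (p : Nat.Primes) (k : ℕ),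
      star (X (prime p)) * (u : B) ^ ((p : ℕ) * k) * X (prime p) = (u : B) ^ k := by
    intro p k
    have h1 := star_mul_zpow_mul_eq_of_shift (hshift p) 0 k
    rw [zero_add, zpow_zero, ← Nat.cast_mul, zpow_natCast, zpow_natCast, SubmonoidClass.coe_pow,
      SubmonoidClass.coe_pow, Submonoid.coe_one, mul_one, h.isometry, one_mul] at h1
    exact h1
  have hstar : ∀ n : ℤ, star (↑(u ^ n) : B) = ↑(u ^ (-n)) := fun n => by
    rw [zpow_neg]
    rfl
  have hs' : ∀ n : ℕ, X two ^ n = ↑(u ^ (2 * n : ℤ)) := fun n => by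
    rw [← hs, ← pow_mul, ← SubmonoidClass.coe_pow, ← zpow_natCast]
    push_cast
    rfl
  have ht' : ∀ n : ℕ, X three ^ n = ↑(u ^ (3 * n : ℤ)) := fun n => by
    rw [← ht, ← pow_mul, ← SubmonoidClass.coe_pow, ← zpow_natCast]
    push_cast
    rfl
  have hss : ∀ n : ℕ, star (X two) ^ n = ↑(u ^ (-(2 * n) : ℤ)) := fun n => by
    rw [← star_pow, hs', hstar]
  have hts : ∀ n : ℕ, star (X three) ^ n = ↑(u ^ (-(3 * n) : ℤ)) := fun n => by
    rw [← star_pow, ht', hstar]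
  have hprime : ∀ (p q : Nat.Primes), (q : ℕ) ≠ p → ¬ (q : ℕ) ∣ p := fun p q hqp hd =>
    hqp ((Nat.prime_dvd_prime_iff_eq q.2 p.2).1 hd)
  exact
  { isometry_s := h.isometry _
    isometry_t := h.isometry _
    isometry_v := fun _ => h.isometry _
    R1 := hR1
    R2a := hR2a
    R2b := hR2b
    R2c := by simpa using congrArg star hR2b
    T1a := hT1a
    T1b := hT1b
    T1c := fun p => by
      rw [hss, ← pow_one (star (X two)), hss, hshift]
      congr 4
      push_cast
      ring
    T1d := fun p => by
      rw [hts, ← pow_one (star (X three)), hts, hshift]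
      congr 4
      push_cast
      ring
    T2 := fun p q => by rw [← h.map_mul, ← h.map_mul, prime_mul_comm]
    T3 := fun p q hpq => by
      refine star_mul_comm_of_range_mul_range (h.isometry _) (h.isometry _) ?_ ?_
      · rw [← h.map_mul, ← h.map_mul, prime_mul_comm]
      · have hne : ((prime p).translate ∩ (prime q).translate).Nonempty :=
          ⟨0, zero_mem_translate_prime p, zero_mem_translate_prime q⟩
        rw [h.covariant_of_nonempty _ _ hne, cup_prime_prime hpq, h.map_mul]
    T4 := fun p => by
      rw [← pow_one (star (X two)), hss, hs', mul_assoc, hshift, ← mul_assoc,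
        ← Submonoid.coe_mul, ← zpow_add, Nat.cast_sub p.2.one_le]
      congr 4
      push_cast
      ring
    T5 := fun p k₁ k₂ h1 h2 => by
      rw [← hs, ← ht, ← pow_mul, ← pow_mul, mul_assoc (star _), ← pow_add]
      exact hzero p _ (Nat.not_dvd_of_pos_of_lt h1 h2)
    T6a := fun p k hp h1 h2 => by
      rw [← hs, ← pow_mul]
      refine hzero p _ fun hd => ?_
      rcases p.2.dvd_mul.1 hd with hd | hd
      · exact hprime ⟨2, Nat.prime_two⟩ p hp hd
      · exact Nat.not_dvd_of_pos_of_lt h1 h2 hd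
    T6b := fun p hp => by
      rw [← hu, ← hs]
      simpa [hp] using hcancel p 1
    T6c := fun p k hp h1 h2 => by
      rw [← ht, ← pow_mul]
      refine hzero p _ fun hd => ?_
      rcases p.2.dvd_mul.1 hd with hd | hd
      · exact hprime ⟨3, Nat.prime_three⟩ p hp hd
      · exact Nat.not_dvd_of_pos_of_lt h1 h2 hd
    T6d := fun p hp => by
      rw [← hu, ← ht]
      simpa [hp] using hcancel p 1
    T6e := fun p hp => by
      rw [← ht, ← pow_mul, ← hs]
      simpa [hp] using hcancel p 2
    T6f := fun p k h1 h2 => by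
      have hcomm : Commute (X three) (star (X two)) := hR2b.symm
      rw [mul_assoc (star _), ← hcomm.mul_pow, ← hu]
      exact hzero p _ (Nat.not_dvd_of_pos_of_lt h1 h2) }

end

end PNToeplitz

/-! ### The isomorphism -/

open PNToeplitz in
theorem mainTheorem1 :
    ∃ π : PNToeplitz.Toeplitz ≃⋆ₐ[ℂ] PNToeplitz.Presented,
      π (PNToeplitz.W PNToeplitz.PN.two) = PNToeplitz.Presented.s ∧
      π (PNToeplitz.W PNToeplitz.PN.three) = PNToeplitz.Presented.t ∧
      ∀ p : Nat.Primes, π (PNToeplitz.W (PNToeplitz.PN.prime p)) = PNToeplitz.Presented.v p := by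
  obtain ⟨u, hs, ht, hV⟩ := satisfiesRelations_gen.exists_isAffinePair
  obtain ⟨φ, hφ, -⟩ := Toeplitz.existsUnique_hom hV.isCovariantRep
  obtain ⟨ψ, ⟨hψs, hψt, hψv⟩, -⟩ :=
    Presented.existsUnique_hom isCovariantRep_W.satisfiesRelations
  have h2 : φ (W PN.two) = Presented.s := by
    rw [hφ, ← hs]
    simp [PN.two, hV.map_one]
  have h3 : φ (W PN.three) = Presented.t := by
    rw [hφ, ← ht]
    simp [PN.three, hV.map_one]
  have hp : ∀ p, φ (W (PN.prime p)) = Presented.v p := fun p => by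
    rw [hφ]
    simpa [PN.prime] using primeProd_prime p
  have hψφ : ψ.comp φ = .id ℂ _ := by
    refine UnivCStar.hom_ext _ fun x => ?_
    -- The Toeplitz algebra is generated by all `W x`; multiplicativity reduces the comparison to
    -- (2,1), (3,1) and (0,p).
    have := PN.hom_ext (f := ((ψ.comp φ : Toeplitz →⋆ₐ[ℂ] Toeplitz) : Toeplitz →* Toeplitz).comp
      isCovariantRep_W.toMonoidHom) (g := isCovariantRep_W.toMonoidHom)
      (show ψ (φ (W PN.two)) = W PN.two by rw [h2, hψs])
      (show ψ (φ (W PN.three)) = W PN.three by rw [h3, hψt])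
      (fun p => show ψ (φ (W (PN.prime p))) = W (PN.prime p) by rw [hp, hψv])
    exact DFunLike.congr_fun this x
  have hφψ : φ.comp ψ = .id ℂ _ := by
    refine UnivCStar.hom_ext _ ?_
    rintro (_ | _ | p)
    · exact (congrArg φ hψs).trans h2
    · exact (congrArg φ hψt).trans h3
    · exact (congrArg φ (hψv p)).trans (hp p)
  exact ⟨StarAlgEquiv.ofStarAlgHom φ ψ hψφ hφψ, h2, h3, hp⟩
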